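/- Let $A$ and $B$ be process templates with disjoint finite state sets $Q_A,Q_B$, initial states $\mathsf{init}_A,\mathsf{init}_B$, finite input alphabets $\Sigma_A,\Sigma_B$, and guarded transition relations $\delta_U\subseteq Q_U\times\Sigma_U\times\mathcal P(Q_A\cup Q_B)\times Q_U$ for $U\in\{A,B\}$. Write $|B|=|Q_B|$. The disjunctive system $(A,B)^{(1,n)}$ consists of one process $A$ and $n$ processes $B_1,\dots,B_n$ (copies of $B$), all starting in their initial states. In each step exactly one process $p$ moves, along a local transition $(q,\sigma,g,q')$ such that $q$ is its current local state, $\sigma$ is its current input, and some process different from $p$ is currently in a state belonging to $g$; the local state of $p$ becomes $q'$ and all other local states are unchanged. The input of each process is arbitrary at the start and may change, arbitrarily, only when that process moves. An infinite run is unconditionally fair if every process moves infinitely often in it. For $1\le k\le n$ let $h(A,B^{(k)})=h(A,B_1,\dots,B_k)$ be an LTL formula without the next-time operator, over atomic propositions for the local states and inputs of $A$ and of $B_1,\dots,B_k$. Write $(A,B)^{(1,n)}\models \mathsf E_{\mathrm{uncond}}\,h(A,B^{(k)})$ if some unconditionally fair run of $(A,B)^{(1,n)}$ satisfies $h(A,B_1,\dots,B_k)$.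 A number $c$ is a cutoff for a property $\Phi$ if for all $n\ge c$: $(A,B)^{(1,n)}\models\Phi \iff (A,B)^{(1,c)}\models\Phi$. Then, for all such templates $A$ and $B$: 1. (Monotonicity) for every formula $h(A,B_1)$ and all $n\ge 1$, $(A,B)^{(1,n)}\models \mathsf E_{\mathrm{uncond}}\,h(A,B_1)$ implies $(A,B)^{(1,n+1)}\models \mathsf E_{\mathrm{uncond}}\,h(A,B_1)$; 2. (Bounding) for every formula $h(A,B_1)$ and all $n>2|B|$, $(A,B)^{(1,n)}\models \mathsf E_{\mathrm{uncond}}\,h(A,B_1)$ implies $(A,B)^{(1,2|B|)}\models \mathsf E_{\mathrm{uncond}}\,h(A,B_1)$; 3. consequently $2|B|$ is a cutoff for $\mathsf E_{\mathrm{uncond}}\,h(A,B_1)$; 4. more generally, for every $k\ge 1$ and every formula $h(A,B^{(k)})$, $2|B|+k-1$ is a cutoff for $\mathsf E_{\mathrm{uncond}}\,h(A,B^{(k)})$. -/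

import Mathlib

namespace GuardedProtocol

/-- A process template with state set `Q`, input alphabet `I` and guards that are subsets of `G`
(for templates `A`, `B` of a system, `G` is the disjoint union `QA ⊕ QB` of the two state sets).
`trans q σ g q'` says that `(q, σ, g, q')` belongs to the guarded transition relation. -/
structure ProcessTemplate (Q I G : Type*) where
  init : Q
  trans : Q → I → Set G → Q → Prop

/-- The processes of the system `(A,B)^(1,n)`: one copy of `A` and `n` copies of `B`. The process
`B i` with `i : Fin n` is the `(i+1)`-st copy of `B`. -/
inductive Proc (n : ℕ) where
  | A : Proc n
  | B : Fin n → Proc n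

/-- A vector with one entry for the `A`-process and one entry for each of the `n` `B`-processes.
It is used for global states and for global inputs. -/
structure GlobalVec (X Y : Type*) (n : ℕ) where
  a : X
  b : Fin n → Y

/-- The local state of process `p` in a global state, as an element of `QA ⊕ QB`. -/
def GlobalVec.loc {QA QB : Type*} {n : ℕ} (s : GlobalVec QA QB n) : Proc n → QA ⊕ QB
  | .A => Sum.inl s.a
  | .B i => Sum.inr (s.b i)

/-- Two global inputs agree at process `p`. -/
def GlobalVec.AgreeAt {X Y : Type*} {n : ℕ} (e e' : GlobalVec X Y n) : Proc n → Prop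
  | .A => e.a = e'.a
  | .B i => e.b i = e'.b i

/-- Disjunctive interpretation of guards: some process different from `p` is in a state of `g`. -/
def GuardSat {QA QB : Type*} {n : ℕ} (s : GlobalVec QA QB n) (p : Proc n)
    (g : Set (QA ⊕ QB)) : Prop :=
  ∃ p' : Proc n, p' ≠ p ∧ s.loc p' ∈ g

section System

variable {QA IA QB IB : Type*}
variable (A : ProcessTemplate QA IA (QA ⊕ QB)) (B : ProcessTemplate QB IB (QA ⊕ QB))

/-- `Step A B s e p s'`: the disjunctive system has the global transition `(s, e, s')`, based on
an enabled local transition of process `p`. Only the local state of `p` is replaced. -/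
def Step {n : ℕ} (s : GlobalVec QA QB n) (e : GlobalVec IA IB n) (p : Proc n)
    (s' : GlobalVec QA QB n) : Prop :=
  match p with
  | .A => ∃ g, A.trans s.a e.a g s'.a ∧ GuardSat s .A g ∧ s'.b = s.b
  | .B i => ∃ g, B.trans (s.b i) (e.b i) g (s'.b i) ∧ GuardSat s (.B i) g ∧
      s'.a = s.a ∧ ∀ j, j ≠ i → s'.b j = s.b j

/-- The global initial state. -/
def initState (n : ℕ) : GlobalVec QA QB n where
  a := A.init
  b := fun _ => B.init

end System

/-- A configuration of an infinite run: global state, global input, and the process that moves. -/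
structure Config (QA IA QB IB : Type*) (n : ℕ) where
  state : GlobalVec QA QB n
  input : GlobalVec IA IB n
  mover : Proc n

/-- Infinite runs of the disjunctive system `(A,B)^(1,n)`. The input of a process stays unchanged
until that process moves. (Finite, i.e. globally deadlocked, runs are never unconditionally fair,
so they play no role in the properties below.) -/
structure IsInfiniteRun {QA IA QB IB : Type*}
    (A : ProcessTemplate QA IA (QA ⊕ QB)) (B : ProcessTemplate QB IB (QA ⊕ QB)) {n : ℕ}
    (x : ℕ → Config QA IA QB IB n) : Prop where
  init : (x 0).state = initState A B n
  step : ∀ t, Step A B (x t).state (x t).input (x t).mover (x (t + 1)).state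
  input_kept : ∀ t p, (x (t + 1)).input.AgreeAt (x t).input p ∨ (x t).mover = p

/-- Unconditional fairness: every process moves infinitely often. -/
def UncondFair {QA IA QB IB : Type*} {n : ℕ} (x : ℕ → Config QA IA QB IB n) : Prop :=
  ∀ p : Proc n, ∀ t : ℕ, ∃ t' : ℕ, t ≤ t' ∧ (x t').mover = p

/-- Formulas of LTL without the next-time operator, over atomic propositions `P`. All other
Boolean and temporal operators (or, eventually, always, release, ...) are derived. -/
inductive LTLX (P : Type*) where
  | tru : LTLX P
  | atom : P → LTLX P
  | neg : LTLX P → LTLX P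
  | and : LTLX P → LTLX P → LTLX P
  | untl : LTLX P → LTLX P → LTLX P

/-- `φ.Sat w t`: the infinite word `w` of sets of atomic propositions satisfies `φ` at time `t`. -/
def LTLX.Sat {P : Type*} (w : ℕ → Set P) : LTLX P → ℕ → Prop
  | .tru, _ => True
  | .atom p, t => p ∈ w t
  | .neg φ, t => ¬ φ.Sat w t
  | .and φ ψ, t => φ.Sat w t ∧ ψ.Sat w t
  | .untl φ ψ, t => ∃ j, t ≤ j ∧ ψ.Sat w j ∧ ∀ i, t ≤ i → i < j → φ.Sat w i

/-- Atomic propositions of a formula `h(A,B_1,...,B_k)`: states and inputs of `A`, and states and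
inputs of `B`, the latter indexed by one of the `k` processes the formula talks about. -/
inductive AP (QA IA QB IB : Type*) (k : ℕ) where
  | stateA : QA → AP QA IA QB IB k
  | inputA : IA → AP QA IA QB IB k
  | stateB : Fin k → QB → AP QA IA QB IB k
  | inputB : Fin k → IB → AP QA IA QB IB k

/-- The atomic proposition holds in the configuration, where index `j : Fin k` of the formula
refers to the `B`-process `ι j` of the system. -/
def AP.Holds {QA IA QB IB : Type*} {k n : ℕ} (ι : Fin k → Fin n)
    (c : Config QA IA QB IB n) : AP QA IA QB IB k → Prop
  | .stateA q => c.state.a = q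
  | .inputA σ => c.input.a = σ
  | .stateB j q => c.state.b (ι j) = q
  | .inputB j σ => c.input.b (ι j) = σ

/-- The word of sets of atomic propositions that a run produces. -/
def trace {QA IA QB IB : Type*} {k n : ℕ} (ι : Fin k → Fin n)
    (x : ℕ → Config QA IA QB IB n) (t : ℕ) : Set (AP QA IA QB IB k) :=
  {p | p.Holds ι (x t)}

/-- `(A,B)^(1,n) ⊨ E_uncond h(A,B^(k))`: we have `k ≤ n`, and some unconditionally fair run of
the disjunctive system with `n` copies of `B` satisfies `h(A,B_1,...,B_k)`. -/
def SatEUncond {QA IA QB IB : Type*}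
    (A : ProcessTemplate QA IA (QA ⊕ QB)) (B : ProcessTemplate QB IB (QA ⊕ QB)) {k : ℕ}
    (h : LTLX (AP QA IA QB IB k)) (n : ℕ) : Prop :=
  ∃ hk : k ≤ n, ∃ x : ℕ → Config QA IA QB IB n,
    IsInfiniteRun A B x ∧ UncondFair x ∧ h.Sat (trace (Fin.castLE hk) x) 0

/-- `c` is a cutoff for a property `Φ` of systems, `Φ n` being its truth in `(A,B)^(1,n)`. -/
def IsCutoff (Φ : ℕ → Prop) (c : ℕ) : Prop :=
  ∀ n, c ≤ n → (Φ n ↔ Φ c)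

end GuardedProtocol

open GuardedProtocol

/-! Formulas without next-time see runs only up to stuttering, so it suffices to keep `A` and the
first `k` copies of `B` as they are and to replace the other copies by few "actors", as long as
every guard used stays satisfied. Since guards are disjunctive, an actor may move along with any
copy in the same state, and only the set of occupied states matters. If every state holding a
resting unobserved copy also holds an actor that rests there or merely takes a self-loop at an idle
step (`Cover`), the simultaneous moves can be serialized, and observed processes only stutter
(`satEUncond_of_cover`).

It remains to count actors. Doubling a copy adds one actor, which gives monotonicity. For bounding,
a state visited only finitely often by unobserved copies needs one actor; a set `S` of states, each
visited infinitely often by one and the same unobserved copy, needs `S.card + 1`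
(`IsLazyRun.cover_finset`). Hence two per state suffice. One more is saved at a state `r` that `B₁`
visits infinitely often: if `r` recurs for an unobserved copy, this copy either recurs in a second
state, so three actors serve two states, or finally loops in `r`, so one actor can loop there too.
Together with the `k` observed copies this makes `2|B| + k - 1`. -/

namespace GuardedProtocol

/-! ### Stuttering invariance of LTL without next-time -/

/-- Index maps of stutterings: they start at `0`, advance by at most one, and are unbounded. -/
structure IsStutter (f : ℕ → ℕ) : Prop where
  zero : f 0 = 0
  succ : ∀ t, f (t + 1) = f t ∨ f (t + 1) = f t + 1
  unbounded : ∀ N, ∃ t, N ≤ f t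

theorem IsStutter.monotone {f : ℕ → ℕ} (hf : IsStutter f) : Monotone f :=
  monotone_nat_of_le_succ fun t => by rcases hf.succ t with h | h <;> omega

/-- A map with steps of size at most one skips no value, so the first time at which it is at least
`J` it equals `J`. -/
theorem IsStutter.exists_first {f : ℕ → ℕ} (hf : IsStutter f) {t J : ℕ} (h : f t ≤ J) :
    ∃ j, t ≤ j ∧ f j = J ∧ ∀ i, t ≤ i → i < j → f i < J := by
  classical
  have hex : ∃ j, t ≤ j ∧ J ≤ f j := by
    obtain ⟨N, hN⟩ := hf.unbounded J
    exact ⟨max t N, le_max_left _ _, hN.trans (hf.monotone (le_max_right _ _))⟩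
  have hmin : ∀ i, t ≤ i → i < Nat.find hex → f i < J := fun i hi hlt => by
    have := Nat.find_min hex hlt
    push Not at this
    exact this hi
  obtain ⟨h1, h2⟩ := Nat.find_spec hex
  refine ⟨Nat.find hex, h1, le_antisymm ?_ h2, hmin⟩
  rcases h1.eq_or_lt with h3 | h3
  · rw [← h3]; exact h
  · obtain ⟨j, hj⟩ : ∃ j, Nat.find hex = j + 1 := ⟨Nat.find hex - 1, by omega⟩
    have := hmin j (by omega) (by omega)
    rw [hj]
    rcases hf.succ j with h | h <;> omega

/-- For `untl`, a witness `J` is pulled back to the first time showing `J`, so that all earlier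
times from `t` on show values below `J`; conversely every value before `f j` is shown before `j`. -/
theorem LTLX.sat_stutter {P : Type*} {w v : ℕ → Set P} {f : ℕ → ℕ} (hf : IsStutter f)
    (hw : ∀ t, w t = v (f t)) (φ : LTLX P) (t : ℕ) : φ.Sat w t ↔ φ.Sat v (f t) := by
  induction φ generalizing t with
  | tru => exact Iff.rfl
  | atom p => simp only [LTLX.Sat, hw]
  | neg φ ih => simp only [LTLX.Sat, ih]
  | and φ ψ ih₁ ih₂ => simp only [LTLX.Sat, ih₁, ih₂]
  | untl φ ψ ih₁ ih₂ =>
    constructor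
    · rintro ⟨j, htj, hj, hi⟩
      refine ⟨f j, hf.monotone htj, (ih₂ j).1 hj, fun I hI hIj => ?_⟩
      obtain ⟨i, hti, rfl, -⟩ := hf.exists_first hI
      refine (ih₁ i).1 (hi i hti ?_)
      by_contra hc
      exact absurd (hf.monotone (not_lt.1 hc)) (not_le.2 hIj)
    · rintro ⟨J, htJ, hJ, hI⟩
      obtain ⟨j, htj, rfl, hlt⟩ := hf.exists_first htJ
      exact ⟨j, htj, (ih₂ j).2 hJ, fun i hti hij =>
        (ih₁ i).2 (hI _ (hf.monotone hti) (hlt i hti hij))⟩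

/-! ### Agreement of global vectors at a process -/

section Agree

variable {X Y : Type*} {n : ℕ}

theorem GlobalVec.agreeAt_refl (v : GlobalVec X Y n) (p : Proc n) : v.AgreeAt v p := by
  cases p <;> rfl

theorem GlobalVec.AgreeAt.symm {v w : GlobalVec X Y n} {p : Proc n} (h : v.AgreeAt w p) :
    w.AgreeAt v p := by
  cases p <;> exact Eq.symm h

theorem GlobalVec.AgreeAt.trans {u v w : GlobalVec X Y n} {p : Proc n} (h : u.AgreeAt v p)
    (h' : v.AgreeAt w p) : u.AgreeAt w p := by
  cases p <;> exact Eq.trans h h'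

theorem GlobalVec.ext_agreeAt {v w : GlobalVec X Y n} (h : ∀ p, v.AgreeAt w p) : v = w := by
  have ha : v.a = w.a := h .A
  have hb : v.b = w.b := funext fun i => h (.B i)
  cases v; cases w; cases ha; cases hb; rfl

theorem GlobalVec.AgreeAt.loc_eq {v w : GlobalVec X Y n} {p : Proc n} (h : v.AgreeAt w p) :
    v.loc p = w.loc p := by
  cases p
  · exact congrArg Sum.inl h
  · exact congrArg Sum.inr h

end Agree

/-! ### Observations and runs with idle steps -/

variable {QA IA QB IB : Type*}

/-- Process `p` has, at its local state in `s` and input in `e`, a local transition with guard `g`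
to its local state in `s'`. -/
def LocalTrans (A : ProcessTemplate QA IA (QA ⊕ QB)) (B : ProcessTemplate QB IB (QA ⊕ QB)) {n : ℕ}
    (s : GlobalVec QA QB n) (e : GlobalVec IA IB n) (s' : GlobalVec QA QB n) (g : Set (QA ⊕ QB)) :
    Proc n → Prop
  | .A => A.trans s.a e.a g s'.a
  | .B i => B.trans (s.b i) (e.b i) g (s'.b i)

/-- The set of atomic propositions that hold for a global state and a global input. -/
def obs {k n : ℕ} (ι : Fin k → Fin n) (s : GlobalVec QA QB n) (e : GlobalVec IA IB n) :
    Set (AP QA IA QB IB k) :=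
  {p | p.Holds ι ⟨s, e, .A⟩}

theorem trace_eq_obs {k n : ℕ} (ι : Fin k → Fin n) (x : ℕ → Config QA IA QB IB n) (t : ℕ) :
    trace ι x t = obs ι (x t).state (x t).input := by
  ext p; cases p <;> rfl

theorem obs_congr {k n n' : ℕ} {ι : Fin k → Fin n} {ι' : Fin k → Fin n'}
    {s : GlobalVec QA QB n} {e : GlobalVec IA IB n}
    {s' : GlobalVec QA QB n'} {e' : GlobalVec IA IB n'}
    (ha : s.a = s'.a) (hb : ∀ i, s.b (ι i) = s'.b (ι' i))
    (hea : e.a = e'.a) (heb : ∀ i, e.b (ι i) = e'.b (ι' i)) :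
    obs ι s e = obs ι' s' e' := by
  ext p
  cases p <;> simp [obs, AP.Holds, ha, hb, hea, heb]

variable (A : ProcessTemplate QA IA (QA ⊕ QB)) (B : ProcessTemplate QB IB (QA ⊕ QB))

theorem step_of_localTrans {n : ℕ} {s s' : GlobalVec QA QB n} {e : GlobalVec IA IB n} {p : Proc n}
    {g : Set (QA ⊕ QB)} (h : LocalTrans A B s e s' g p) (hg : GuardSat s p g)
    (hs : ∀ p', p' ≠ p → s'.AgreeAt s p') : Step A B s e p s' := by
  cases p with
  | A => exact ⟨g, h, hg, funext fun i => hs (.B i) (by simp)⟩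
  | B i => exact ⟨g, h, hg, hs .A (by simp), fun j hj => hs (.B j) (by simpa using hj)⟩

theorem Step.exists_localTrans {n : ℕ} {s s' : GlobalVec QA QB n} {e : GlobalVec IA IB n}
    {p : Proc n} (h : Step A B s e p s') :
    (∃ g, LocalTrans A B s e s' g p ∧ GuardSat s p g) ∧ ∀ p', p' ≠ p → s'.AgreeAt s p' := by
  cases p with
  | A =>
    obtain ⟨g, h, hg, hs⟩ := h
    refine ⟨⟨g, h, hg⟩, fun p' hp' => ?_⟩
    cases p' with
    | A => exact absurd rfl hp'
    | B j => exact congrFun hs j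
  | B i =>
    obtain ⟨g, h, hg, ha, hb⟩ := h
    refine ⟨⟨g, h, hg⟩, fun p' hp' => ?_⟩
    cases p' with
    | A => exact ha
    | B j => exact hb j (by simpa using hp')

/-- Unconditionally fair runs that may idle: at time `t` either some process moves (`μ t = some p`)
or nothing happens (`μ t = none`). -/
structure IsLazyRun {n : ℕ} (s : ℕ → GlobalVec QA QB n) (e : ℕ → GlobalVec IA IB n)
    (μ : ℕ → Option (Proc n)) : Prop where
  init : s 0 = initState A B n
  step : ∀ t p, μ t = some p → ∃ g, LocalTrans A B (s t) (e t) (s (t + 1)) g p ∧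
    GuardSat (s t) p g
  stay : ∀ t p, μ t ≠ some p → (s (t + 1)).AgreeAt (s t) p
  input_kept : ∀ t p, μ t ≠ some p → (e (t + 1)).AgreeAt (e t) p
  fair : ∀ p t, ∃ t', t ≤ t' ∧ μ t' = some p

variable {A B}

theorem eq_of_agreeAt_of_idle {X Y : Type*} {n : ℕ} {v : ℕ → GlobalVec X Y n}
    {μ : ℕ → Option (Proc n)} (hv : ∀ t p, μ t ≠ some p → (v (t + 1)).AgreeAt (v t) p)
    {a b : ℕ} (hab : a ≤ b) (h : ∀ i, a ≤ i → i < b → μ i = none) : v b = v a := by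
  induction b, hab using Nat.le_induction with
  | base => rfl
  | succ b hab ih =>
    rw [← ih fun i h1 h2 => h i h1 (by omega)]
    refine GlobalVec.ext_agreeAt fun p => hv b p ?_
    rw [h b hab (by omega)]
    simp

/-- Removing the idle steps of a lazy run. -/
theorem IsLazyRun.exists_run {n : ℕ} {s : ℕ → GlobalVec QA QB n} {e : ℕ → GlobalVec IA IB n}
    {μ : ℕ → Option (Proc n)} (H : IsLazyRun A B s e μ) :
    ∃ (x : ℕ → Config QA IA QB IB n) (f : ℕ → ℕ), IsInfiniteRun A B x ∧ UncondFair x ∧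
      IsStutter f ∧ ∀ t, s t = (x (f t)).state ∧ e t = (x (f t)).input := by
  classical
  let P : ℕ → Prop := fun t => μ t ≠ none
  have hinf : (Set.ofPred P).Infinite := by
    refine Set.infinite_of_not_bddAbove ?_
    rintro ⟨N, hN⟩
    obtain ⟨t, ht, h⟩ := H.fair .A (N + 1)
    have : t ≤ N := hN (show P t by simp [P, h])
    omega
  -- `Nat.nth P (Nat.count P T)` is the first busy time at or after `T`. Nothing changes until then,
  -- so `Nat.count P` maps `T` to the index of its configuration in the compressed run.
  have hidle : ∀ T i, T ≤ i → i < Nat.nth P (Nat.count P T) → μ i = none := by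
    intro T i hTi hi
    by_contra hc
    have h1 : Nat.nth P (Nat.count P i) = i := Nat.nth_count hc
    have h2 := (Nat.nth_le_nth hinf).2 (Nat.count_monotone P hTi)
    omega
  have hle : ∀ T, T ≤ Nat.nth P (Nat.count P T) := fun T => Nat.le_nth_count hinf T
  have hs : ∀ T, s (Nat.nth P (Nat.count P T)) = s T := fun T =>
    eq_of_agreeAt_of_idle H.stay (hle T) (hidle T)
  have he : ∀ T, e (Nat.nth P (Nat.count P T)) = e T := fun T =>
    eq_of_agreeAt_of_idle H.input_kept (hle T) (hidle T)
  have hcount : ∀ i, Nat.count P (Nat.nth P i) = i := fun i => Nat.count_nth_of_infinite hinf i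
  have hmem : ∀ i, P (Nat.nth P i) := fun i => Nat.nth_mem_of_infinite hinf i
  have hcs : ∀ i, Nat.count P (Nat.nth P i + 1) = i + 1 := fun i => by
    rw [Nat.count_succ, hcount, if_pos (hmem i)]
  choose m hm using fun i => Option.ne_none_iff_exists'.1 (hmem i)
  have hs' : ∀ i, s (Nat.nth P (i + 1)) = s (Nat.nth P i + 1) := fun i => by
    rw [← hs (Nat.nth P i + 1), hcs]
  have he' : ∀ i, e (Nat.nth P (i + 1)) = e (Nat.nth P i + 1) := fun i => by
    rw [← he (Nat.nth P i + 1), hcs]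
  refine ⟨fun i => ⟨s (Nat.nth P i), e (Nat.nth P i), m i⟩, Nat.count P, ⟨?_, ?_, ?_⟩, ?_,
    ⟨Nat.count_zero P, ?_, fun N => ⟨Nat.nth P N, (hcount N).ge⟩⟩,
    fun t => ⟨(hs t).symm, (he t).symm⟩⟩
  · have := hs 0
    rw [Nat.count_zero] at this
    exact this.trans H.init
  · intro i
    obtain ⟨g, h1, h2⟩ := H.step _ _ (hm i)
    dsimp only
    rw [hs']
    refine step_of_localTrans A B h1 h2 fun p' hp' => H.stay _ _ ?_
    rw [hm]
    simpa using hp'.symm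
  · intro i p
    by_cases hp : m i = p
    · exact Or.inr hp
    · left
      dsimp only
      rw [he']
      refine H.input_kept _ _ ?_
      rw [hm]
      simpa using hp
  · intro p i
    obtain ⟨t, ht, h⟩ := H.fair p (Nat.nth P i)
    refine ⟨Nat.count P t, ?_, ?_⟩
    · have := Nat.count_monotone P ht
      rwa [hcount] at this
    · have h1 : Nat.nth P (Nat.count P t) = t := Nat.nth_count (show P t by simp [P, h])
      have h2 := hm (Nat.count P t)
      rw [h1, h] at h2
      exact (Option.some_injective _ h2).symm
  · intro t
    rw [Nat.count_succ]
    split_ifs <;> simp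

theorem isStutter_div_two : IsStutter fun t => t / 2 :=
  ⟨rfl, fun t => by omega, fun N => ⟨2 * N, by omega⟩⟩

/-- Inserting an idle step before each step of a run. -/
theorem IsInfiniteRun.isLazyRun {n : ℕ} {x : ℕ → Config QA IA QB IB n} (hx : IsInfiniteRun A B x)
    (hf : UncondFair x) :
    IsLazyRun A B (fun t => (x (t / 2)).state) (fun t => (x (t / 2)).input)
      (fun t => if t % 2 = 0 then none else some (x (t / 2)).mover) := by
  have hdiv : ∀ t, t % 2 = 0 → (t + 1) / 2 = t / 2 := fun t h => by omega
  have hdiv' : ∀ t, ¬ t % 2 = 0 → (t + 1) / 2 = t / 2 + 1 := fun t h => by omega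
  refine ⟨hx.init, fun t p h => ?_, fun t p h => ?_, fun t p h => ?_, fun p t => ?_⟩
  · split_ifs at h with h2
    rw [hdiv' t h2, ← Option.some_injective _ h]
    exact (Step.exists_localTrans A B (hx.step (t / 2))).1
  · split_ifs at h with h2
    · rw [hdiv t h2]; exact GlobalVec.agreeAt_refl _ _
    · rw [hdiv' t h2]
      exact (Step.exists_localTrans A B (hx.step (t / 2))).2 p fun h' => h (by rw [h'])
  · split_ifs at h with h2
    · rw [hdiv t h2]; exact GlobalVec.agreeAt_refl _ _
    · rw [hdiv' t h2]
      exact (hx.input_kept (t / 2) p).resolve_right fun h' => h (by rw [h'])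
  · obtain ⟨u, hu, hp⟩ := hf p t
    refine ⟨2 * u + 1, by omega, ?_⟩
    rw [if_neg (by omega), show (2 * u + 1) / 2 = u by omega, hp]

end GuardedProtocol

/-! ### Serializing simultaneous moves -/

namespace GuardedProtocol

variable {QA IA QB IB : Type*}

theorem LocalTrans.congr {A : ProcessTemplate QA IA (QA ⊕ QB)}
    {B : ProcessTemplate QB IB (QA ⊕ QB)} {n : ℕ} {s₁ s₂ s₁' s₂' : GlobalVec QA QB n}
    {e₁ e₂ : GlobalVec IA IB n} {g : Set (QA ⊕ QB)} {p : Proc n}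
    (h : LocalTrans A B s₁ e₁ s₁' g p) (hs : s₂.AgreeAt s₁ p) (he : e₂.AgreeAt e₁ p)
    (hs' : s₂'.AgreeAt s₁' p) : LocalTrans A B s₂ e₂ s₂' g p := by
  cases p <;> simp only [LocalTrans, GlobalVec.AgreeAt] at * <;> rwa [hs, he, hs']

/-- Position of a process in the order in which simultaneous moves are executed. -/
def Proc.slot {n : ℕ} : Proc n → ℕ
  | .A => 0
  | .B i => i + 1

theorem Proc.slot_lt {n : ℕ} (p : Proc n) : p.slot < n + 1 := by
  cases p <;> simp [Proc.slot]

theorem Proc.slot_injective {n : ℕ} : Function.Injective (Proc.slot (n := n)) := by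
  intro p q h
  cases p <;> cases q <;> simp_all [Proc.slot, Fin.ext_iff]

/-- The processes in slots below `c` take their entry from `w`, the others from `v`. -/
def GlobalVec.mix {X Y : Type*} {n : ℕ} (c : ℕ) (v w : GlobalVec X Y n) : GlobalVec X Y n where
  a := if 0 < c then w.a else v.a
  b i := if (i : ℕ) + 1 < c then w.b i else v.b i

section Mix

variable {X Y : Type*} {n : ℕ}

theorem GlobalVec.mix_agreeAt_right {c : ℕ} (v w : GlobalVec X Y n) {p : Proc n} (h : p.slot < c) :
    (GlobalVec.mix c v w).AgreeAt w p := by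
  cases p <;> exact if_pos h

theorem GlobalVec.mix_agreeAt_left {c : ℕ} (v w : GlobalVec X Y n) {p : Proc n}
    (h : ¬ p.slot < c) : (GlobalVec.mix c v w).AgreeAt v p := by
  cases p <;> exact if_neg h

theorem GlobalVec.mix_agreeAt_of_agreeAt {c : ℕ} {v w : GlobalVec X Y n} {p : Proc n}
    (h : w.AgreeAt v p) : (GlobalVec.mix c v w).AgreeAt v p := by
  by_cases hc : p.slot < c
  · exact (mix_agreeAt_right v w hc).trans h
  · exact mix_agreeAt_left v w hc

/-- The sequence that replaces each step of `v` by `n + 1` steps, one for each process. -/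
def serialize (v : ℕ → GlobalVec X Y n) (T : ℕ) : GlobalVec X Y n :=
  GlobalVec.mix (T % (n + 1)) (v (T / (n + 1))) (v (T / (n + 1) + 1))

theorem div_mod_succ (N T : ℕ) :
    ((T + 1) / (N + 1) = T / (N + 1) ∧ (T + 1) % (N + 1) = T % (N + 1) + 1) ∨
      ((T + 1) / (N + 1) = T / (N + 1) + 1 ∧ (T + 1) % (N + 1) = 0 ∧ T % (N + 1) = N) := by
  have h1 := Nat.div_add_mod T (N + 1)
  have h2 := Nat.mod_lt T (Nat.add_one_pos N)
  rcases Nat.lt_or_ge (T % (N + 1)) N with h | h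
  · left
    rw [Nat.div_mod_unique (Nat.add_one_pos N)]
    exact ⟨by omega, by omega⟩
  · right
    have : (T + 1) / (N + 1) = T / (N + 1) + 1 ∧ (T + 1) % (N + 1) = 0 := by
      rw [Nat.div_mod_unique (Nat.add_one_pos N)]
      refine ⟨?_, by omega⟩
      rw [mul_add]
      omega
    exact ⟨this.1, this.2, by omega⟩

/-- At a block boundary the fully updated mixture is the untouched start of the next block; hence
positions `T` and `T + 1` are always mixtures of the same two vectors. -/
theorem serialize_succ (v : ℕ → GlobalVec X Y n) (T : ℕ) :
    serialize v (T + 1) =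
      GlobalVec.mix (T % (n + 1) + 1) (v (T / (n + 1))) (v (T / (n + 1) + 1)) := by
  rcases div_mod_succ n T with ⟨h1, h2⟩ | ⟨h1, h2, h3⟩
  · rw [serialize, h1, h2]
  · rw [serialize, h1, h2, h3]
    exact GlobalVec.ext_agreeAt fun p => (GlobalVec.mix_agreeAt_left _ _ (Nat.not_lt_zero _)).trans
      (GlobalVec.mix_agreeAt_right _ _ p.slot_lt).symm

theorem serialize_succ_agreeAt {v : ℕ → GlobalVec X Y n} {M : ℕ → Proc n → Prop}
    (hv : ∀ t p, ¬ M t p → (v (t + 1)).AgreeAt (v t) p) {T : ℕ} {p : Proc n}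
    (h : ¬ (p.slot = T % (n + 1) ∧ M (T / (n + 1)) p)) :
    (serialize v (T + 1)).AgreeAt (serialize v T) p := by
  rw [serialize_succ]
  by_cases hp : p.slot = T % (n + 1)
  · have h1 := hv _ _ fun hM => h ⟨hp, hM⟩
    exact (GlobalVec.mix_agreeAt_of_agreeAt h1).trans (GlobalVec.mix_agreeAt_of_agreeAt h1).symm
  · by_cases hlt : p.slot < T % (n + 1)
    · exact (GlobalVec.mix_agreeAt_right _ _ (by omega)).trans
        (GlobalVec.mix_agreeAt_right _ _ hlt).symm
    · exact (GlobalVec.mix_agreeAt_left _ _ (by omega)).trans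
        (GlobalVec.mix_agreeAt_left _ _ hlt).symm

/-- A process in `O` has already executed its move at position `T` of the serialization. -/
def Overtaken (O : Proc n → Prop) (M : ℕ → Proc n → Prop) (T : ℕ) : Prop :=
  ∃ p, O p ∧ M (T / (n + 1)) p ∧ p.slot < T % (n + 1)

open Classical in
/-- The time of the original sequence that the processes in `O` show at position `T` of the
serialization. -/
noncomputable def observedTime (O : Proc n → Prop) (M : ℕ → Proc n → Prop) (T : ℕ) : ℕ :=
  if Overtaken O M T then T / (n + 1) + 1 else T / (n + 1)

/-- At most one process of `O` changes within a block, so all of `O` jointly shows the old vector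
before that process's slot is executed and the new vector afterwards. -/
theorem serialize_agreeAt {v : ℕ → GlobalVec X Y n} {M : ℕ → Proc n → Prop}
    (hv : ∀ t p, ¬ M t p → (v (t + 1)).AgreeAt (v t) p) {O : Proc n → Prop}
    (hO : ∀ t p p', O p → O p' → M t p → M t p' → p = p') (T : ℕ) {p : Proc n} (hp : O p) :
    (serialize v T).AgreeAt (v (observedTime O M T)) p := by
  unfold observedTime
  split_ifs with hR
  · obtain ⟨q, hq, hM, hlt⟩ := hR
    by_cases hpq : p = q
    · exact GlobalVec.mix_agreeAt_right _ _ (hpq ▸ hlt)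
    · have h1 := hv (T / (n + 1)) p fun h => hpq (hO _ _ _ hp hq h hM)
      exact (GlobalVec.mix_agreeAt_of_agreeAt h1).trans h1.symm
  · by_cases hM : M (T / (n + 1)) p
    · exact GlobalVec.mix_agreeAt_left _ _ fun h => hR ⟨p, hp, hM, h⟩
    · exact GlobalVec.mix_agreeAt_of_agreeAt (hv _ _ hM)

end Mix

/-- Unconditionally fair runs in which several processes may move at once (`M t` is the set of
processes that move at time `t`), where each guard is satisfied by a process that keeps its
state. -/
structure IsConcurrentRun (A : ProcessTemplate QA IA (QA ⊕ QB))
    (B : ProcessTemplate QB IB (QA ⊕ QB)) {n : ℕ} (s : ℕ → GlobalVec QA QB n)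
    (e : ℕ → GlobalVec IA IB n) (M : ℕ → Proc n → Prop) : Prop where
  init : s 0 = initState A B n
  step : ∀ t p, M t p → ∃ g, LocalTrans A B (s t) (e t) (s (t + 1)) g p ∧
    ∃ d, d ≠ p ∧ (s (t + 1)).AgreeAt (s t) d ∧ (s t).loc d ∈ g
  stay : ∀ t p, ¬ M t p → (s (t + 1)).AgreeAt (s t) p
  input_kept : ∀ t p, ¬ M t p → (e (t + 1)).AgreeAt (e t) p
  fair : ∀ p t, ∃ t', t ≤ t' ∧ M t' p

variable {A : ProcessTemplate QA IA (QA ⊕ QB)} {B : ProcessTemplate QB IB (QA ⊕ QB)}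

/-- Executing the simultaneous moves of a concurrent run one after the other stutters on every set
of processes of which at most one moves at a time. -/
theorem IsConcurrentRun.exists_lazyRun {n : ℕ} {s : ℕ → GlobalVec QA QB n}
    {e : ℕ → GlobalVec IA IB n} {M : ℕ → Proc n → Prop} (H : IsConcurrentRun A B s e M)
    {O : Proc n → Prop} (hO : ∀ t p p', O p → O p' → M t p → M t p' → p = p') :
    ∃ (s' : ℕ → GlobalVec QA QB n) (e' : ℕ → GlobalVec IA IB n) (μ : ℕ → Option (Proc n))
      (f : ℕ → ℕ), IsLazyRun A B s' e' μ ∧ IsStutter f ∧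
        ∀ T p, O p → (s' T).AgreeAt (s (f T)) p ∧ (e' T).AgreeAt (e (f T)) p := by
  classical
  let Q : ℕ → Proc n → Prop := fun T p => p.slot = T % (n + 1) ∧ M (T / (n + 1)) p
  let μ : ℕ → Option (Proc n) := fun T => if h : ∃ p, Q T p then some h.choose else none
  have hμ : ∀ T p, μ T = some p ↔ Q T p := by
    intro T p
    by_cases h : ∃ p, Q T p
    · have h1 : μ T = some h.choose := dif_pos h
      rw [h1, Option.some_inj]
      refine ⟨fun h2 => h2 ▸ h.choose_spec, fun h2 => Proc.slot_injective ?_⟩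
      rw [h.choose_spec.1, h2.1]
    · have h1 : μ T = none := dif_neg h
      rw [h1]
      exact ⟨fun h2 => by simp at h2, fun h2 => absurd ⟨p, h2⟩ h⟩
  let R : ℕ → Prop := Overtaken O M
  let f : ℕ → ℕ := observedTime O M
  have hfR : ∀ T, R T → f T = T / (n + 1) + 1 := fun T h => if_pos h
  have hfR' : ∀ T, ¬ R T → f T = T / (n + 1) := fun T h => if_neg h
  refine ⟨serialize s, serialize e, μ, f, ⟨?_, ?_, ?_, ?_, ?_⟩, ⟨?_, ?_, ?_⟩,
    fun T p hp => ⟨serialize_agreeAt H.stay hO T hp, serialize_agreeAt H.input_kept hO T hp⟩⟩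
  · refine GlobalVec.ext_agreeAt fun p => ?_
    have h := GlobalVec.mix_agreeAt_left (c := 0) (s 0) (s 1) (Nat.not_lt_zero p.slot)
    rw [← H.init]
    simpa [serialize] using h
  · intro T p hp
    obtain ⟨hslot, hM⟩ := (hμ T p).1 hp
    obtain ⟨g, h1, d, hd, hd1, hd2⟩ := H.step _ _ hM
    have hl : ¬ p.slot < T % (n + 1) := by omega
    refine ⟨g, h1.congr (GlobalVec.mix_agreeAt_left _ _ hl) (GlobalVec.mix_agreeAt_left _ _ hl) ?_,
      d, hd, ?_⟩
    · rw [serialize_succ]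
      exact GlobalVec.mix_agreeAt_right _ _ (by omega)
    -- The guard's witness keeps its state over the whole block, so it does not matter which other
    -- moves have already been executed.
    · rw [serialize, (GlobalVec.mix_agreeAt_of_agreeAt hd1).loc_eq]
      exact hd2
  · exact fun T p hp => serialize_succ_agreeAt H.stay fun h => hp ((hμ T p).2 h)
  · exact fun T p hp => serialize_succ_agreeAt H.input_kept fun h => hp ((hμ T p).2 h)
  · intro p T
    obtain ⟨t, ht, hM⟩ := H.fair p T
    have h1 : ((n + 1) * t + p.slot) / (n + 1) = t ∧ ((n + 1) * t + p.slot) % (n + 1) = p.slot := by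
      rw [Nat.div_mod_unique (Nat.add_one_pos n)]
      exact ⟨by omega, p.slot_lt⟩
    refine ⟨(n + 1) * t + p.slot, by nlinarith, (hμ _ _).2 ⟨h1.2.symm, ?_⟩⟩
    rwa [h1.1]
  · rw [hfR']
    · exact Nat.zero_div _
    · rintro ⟨p, -, -, h⟩
      simp at h
  · intro T
    rcases div_mod_succ n T with ⟨h1, h2⟩ | ⟨h1, h2, h3⟩
    · by_cases hR : R T
      · have hR' : R (T + 1) := by
          obtain ⟨p, hp, hM, hlt⟩ := hR
          exact ⟨p, hp, by rwa [h1], by omega⟩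
        left
        rw [hfR _ hR, hfR _ hR', h1]
      · rw [hfR' _ hR]
        by_cases hR' : R (T + 1)
        · right; rw [hfR _ hR', h1]
        · left; rw [hfR' _ hR', h1]
    · have hR' : ¬ R (T + 1) := by
        rintro ⟨p, -, -, h⟩
        omega
      rw [hfR' _ hR', h1]
      by_cases hR : R T
      · left; rw [hfR _ hR]
      · right; rw [hfR' _ hR]
  · intro N
    refine ⟨(n + 1) * N, ?_⟩
    have h1 : (n + 1) * N / (n + 1) = N := Nat.mul_div_cancel_left _ (Nat.add_one_pos n)
    by_cases hR : R ((n + 1) * N)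
    · rw [hfR _ hR]; omega
    · rw [hfR' _ hR]; omega

end GuardedProtocol

/-! ### Replacing unobserved copies by actors -/

namespace GuardedProtocol

variable {QA IA QB IB : Type*}

/-- A quantity that may only change at infinitely many given times can be chosen with prescribed
properties at these times. -/
theorem exists_seq_of_infinitely_often {Y : Type*} {M : ℕ → Prop} (hM : ∀ t, ∃ t', t ≤ t' ∧ M t')
    {R : ℕ → Y → Prop} (hR : ∀ t, M t → ∃ y, R t y) :
    ∃ y : ℕ → Y, (∀ t, M t → R t (y t)) ∧ ∀ t, ¬ M t → y (t + 1) = y t := by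
  classical
  have hY : ∀ t, ∃ y, M t → R t y := fun t => by
    by_cases h : M t
    · obtain ⟨y, hy⟩ := hR t h
      exact ⟨y, fun _ => hy⟩
    · obtain ⟨t', -, h'⟩ := hM t
      obtain ⟨y, -⟩ := hR t' h'
      exact ⟨y, fun h'' => absurd h'' h⟩
  choose f hf using hY
  have hspec := fun t => Nat.find_spec (hM t)
  -- The value at `t` is the one needed at the next time of `M` from `t` on.
  refine ⟨fun t => f (Nat.find (hM t)), fun t ht => ?_, fun t ht => ?_⟩
  · have : Nat.find (hM t) = t :=
      le_antisymm (Nat.find_min' _ ⟨le_rfl, ht⟩) (hspec t).1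
    dsimp only
    rw [this]
    exact hf t ht
  · refine congrArg f ?_
    have h3 := (hspec (t + 1)).1
    refine le_antisymm (Nat.find_min' (hM (t + 1)) ⟨?_, (hspec t).2⟩)
      (Nat.find_min' (hM t) ⟨by omega, (hspec (t + 1)).2⟩)
    have h1 := (hspec t).1
    have h2 : Nat.find (hM t) ≠ t := fun h => ht (h ▸ (hspec t).2)
    omega

/-- A copy of `B` in local state `q` that is added to the global state `v` can take a self-loop
whose guard is satisfied by a process that is among the observed ones (`A` and the first `k` copies
of `B`) or in a state different from `q`. -/
def IdleLoop (B : ProcessTemplate QB IB (QA ⊕ QB)) (k : ℕ) {n : ℕ} (v : GlobalVec QA QB n)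
    (q : QB) : Prop :=
  ∃ σ g, B.trans q σ g q ∧ ∃ p : Proc n, v.loc p ∈ g ∧ ∀ i, p = .B i → k ≤ i → v.b i ≠ q

/-- The local behaviour `st` of a copy of `B`, moving at the times in `mv`, that accompanies a lazy
run: it moves along with a copy of `B` in the same state, or takes a self-loop at an idle step. -/
structure IsActor (B : ProcessTemplate QB IB (QA ⊕ QB)) (k : ℕ) {n : ℕ}
    (s : ℕ → GlobalVec QA QB n) (μ : ℕ → Option (Proc n)) (st : ℕ → QB) (mv : ℕ → Prop) :
    Prop where
  init : st 0 = B.init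
  move : ∀ t, mv t →
    (∃ j, μ t = some (.B j) ∧ st t = (s t).b j ∧ st (t + 1) = (s (t + 1)).b j) ∨
      (μ t = none ∧ IdleLoop B k (s t) (st t) ∧ st (t + 1) = st t)
  stay : ∀ t, ¬ mv t → st (t + 1) = st t
  fair : ∀ t, ∃ t', t ≤ t' ∧ mv t'

/-- The behaviours `st d` occupy every state in `S` that contains an unobserved process of the lazy
run which does not move. -/
def Occupies (k : ℕ) {n : ℕ} (s : ℕ → GlobalVec QA QB n) (μ : ℕ → Option (Proc n)) (S : Set QB)
    {C : Type*} (st : C → ℕ → QB) (mv : C → ℕ → Prop) : Prop :=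
  ∀ t (i : Fin n), k ≤ i → (s t).b i ∈ S → μ t ≠ some (.B i) →
    ∃ d, st d t = (s t).b i ∧ (mv d t → μ t = none)

/-- Some `m` actors occupy the states in `S`. -/
def Cover (B : ProcessTemplate QB IB (QA ⊕ QB)) (k : ℕ) {n : ℕ}
    (s : ℕ → GlobalVec QA QB n) (μ : ℕ → Option (Proc n)) (S : Set QB) (m : ℕ) : Prop :=
  ∃ (st : Fin m → ℕ → QB) (mv : Fin m → ℕ → Prop),
    (∀ c, IsActor B k s μ (st c) (mv c)) ∧ Occupies k s μ S st mv

theorem Proc.cases_add {k m : ℕ} (p : Proc (k + m)) :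
    p = .A ∨ (∃ i, p = .B (Fin.castAdd m i)) ∨ ∃ c, p = .B (Fin.natAdd k c) := by
  cases p with
  | A => exact Or.inl rfl
  | B i =>
    refine Or.inr ?_
    induction i using Fin.addCases with
    | left i => exact Or.inl ⟨i, rfl⟩
    | right c => exact Or.inr ⟨c, rfl⟩

/-- Keep the entries of `A` and of the first `k` copies of `B`, and replace the others. -/
def replaceUnobserved {X Y : Type*} {k n m : ℕ} (hk : k ≤ n) (v : GlobalVec X Y n) (y : Fin m → Y) :
    GlobalVec X Y (k + m) where
  a := v.a
  b := Fin.append (fun i => v.b (Fin.castLE hk i)) y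

/-- The movers, when the unobserved copies of `B` are replaced by actors. -/
def actorMovers {k n m : ℕ} (hk : k ≤ n) (μ : Option (Proc n)) (mv : Fin m → Prop) :
    Proc (k + m) → Prop
  | .A => μ = some .A
  | .B i => Fin.append (fun i => μ = some (.B (Fin.castLE hk i))) mv i

variable {A : ProcessTemplate QA IA (QA ⊕ QB)} {B : ProcessTemplate QB IB (QA ⊕ QB)}
variable {k n : ℕ} {s : ℕ → GlobalVec QA QB n} {e : ℕ → GlobalVec IA IB n}
  {μ : ℕ → Option (Proc n)}

/-- Processes of a lazy run that do not move have a counterpart that keeps its state, when the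
unobserved processes are replaced by actors that occupy all states. -/
theorem exists_counterpart (H : IsLazyRun A B s e μ) (hk : k ≤ n) {m : ℕ} {st : Fin m → ℕ → QB}
    {mv : Fin m → ℕ → Prop} (hact : ∀ c, IsActor B k s μ (st c) (mv c))
    (hocc : Occupies k s μ Set.univ st mv) {t : ℕ} {p : Proc n} (hp : μ t ≠ some p) :
    ∃ d : Proc (k + m), (replaceUnobserved hk (s t) (st · t)).loc d = (s t).loc p ∧
      (replaceUnobserved hk (s (t + 1)) (st · (t + 1))).AgreeAt
        (replaceUnobserved hk (s t) (st · t)) d ∧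
      (actorMovers hk (μ t) (mv · t) d → μ t = none) ∧
      ((∀ c, d ≠ .B (Fin.natAdd k c)) ∨ ∃ i, p = .B i ∧ k ≤ i) := by
  cases p with
  | A => exact ⟨.A, rfl, H.stay t .A hp, fun h => absurd h hp, Or.inl fun c => by simp⟩
  | B i =>
    by_cases hi : (i : ℕ) < k
    · obtain ⟨i', rfl⟩ : ∃ i', i = Fin.castLE hk i' := ⟨⟨i, hi⟩, rfl⟩
      refine ⟨.B (Fin.castAdd m i'), ?_, ?_, fun h => ?_, Or.inl fun c h => ?_⟩
      · simp [GlobalVec.loc, replaceUnobserved]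
      · have := H.stay t _ hp
        simpa [GlobalVec.AgreeAt, replaceUnobserved] using this
      · simp only [actorMovers, Fin.append_left] at h
        exact absurd h hp
      · simp only [Proc.B.injEq, Fin.ext_iff, Fin.val_castAdd, Fin.val_natAdd] at h
        have := i'.2
        omega
    · obtain ⟨c, hc, hmv⟩ := hocc t i (not_lt.1 hi) trivial hp
      refine ⟨.B (Fin.natAdd k c), ?_, ?_, fun h => ?_, Or.inr ⟨i, rfl, not_lt.1 hi⟩⟩
      · simp [GlobalVec.loc, replaceUnobserved, hc]
      · simp only [GlobalVec.AgreeAt, replaceUnobserved, Fin.append_right]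
        by_cases h : mv c t
        · rcases (hact c).move t h with ⟨j, hj, -⟩ | ⟨-, -, h'⟩
          · rw [hmv h] at hj
            exact absurd hj (by simp)
          · exact h'
        · exact (hact c).stay t h
      · simp only [actorMovers, Fin.append_right] at h
        exact hmv h

/-- Replacing the unobserved processes of a lazy run by actors that occupy all states. -/
theorem IsLazyRun.exists_concurrentRun (H : IsLazyRun A B s e μ) (hk : k ≤ n) {m : ℕ}
    {st : Fin m → ℕ → QB} {mv : Fin m → ℕ → Prop} (hact : ∀ c, IsActor B k s μ (st c) (mv c))
    (hocc : Occupies k s μ Set.univ st mv) :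
    ∃ y : Fin m → ℕ → IB, IsConcurrentRun A B (fun t => replaceUnobserved hk (s t) (st · t))
      (fun t => replaceUnobserved hk (e t) (y · t)) (fun t => actorMovers hk (μ t) (mv · t)) := by
  have hmove : ∀ c t, mv c t → ∃ σ g, B.trans (st c t) σ g (st c (t + 1)) ∧
      ∃ d : Proc (k + m), d ≠ .B (Fin.natAdd k c) ∧
        (replaceUnobserved hk (s (t + 1)) (st · (t + 1))).AgreeAt
          (replaceUnobserved hk (s t) (st · t)) d ∧
        (replaceUnobserved hk (s t) (st · t)).loc d ∈ g := by
    intro c t ht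
    -- When the actor follows `B j`, the counterpart of the guard's witness is not moving, hence is
    -- not the actor itself. At an idle self-loop it is either observed or, by `IdleLoop`, in
    -- another state than the actor.
    rcases (hact c).move t ht with ⟨j, hj, h1, h2⟩ | ⟨hμ, ⟨σ, g, htr, p, hp, hne⟩, h2⟩
    · obtain ⟨g, htr, p, hpj, hp⟩ := H.step t _ hj
      refine ⟨(e t).b j, g, by rw [h1, h2]; exact htr, ?_⟩
      have hp' : μ t ≠ some p := by
        rw [hj]
        exact fun h => hpj (Option.some_injective _ h).symm
      obtain ⟨d, hd1, hd2, hd3, -⟩ := exists_counterpart H hk hact hocc hp'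
      refine ⟨d, ?_, hd2, hd1 ▸ hp⟩
      rintro rfl
      have := hd3 (by simpa [actorMovers] using ht)
      rw [hj] at this
      simp at this
    · refine ⟨σ, g, by rwa [h2], ?_⟩
      obtain ⟨d, hd1, hd2, -, hd4⟩ := exists_counterpart H hk hact hocc (t := t) (p := p)
        (by simp [hμ])
      refine ⟨d, ?_, hd2, hd1 ▸ hp⟩
      rcases hd4 with hd4 | ⟨i, rfl, hi⟩
      · exact hd4 c
      · rintro rfl
        refine hne i rfl hi ?_
        simpa [GlobalVec.loc, replaceUnobserved] using hd1.symm
  -- The actors' inputs are unobserved, so each may already hold the letter required for its next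
  -- move.
  choose y hy1 hy2 using fun c => exists_seq_of_infinitely_often (hact c).fair (hmove c)
  refine ⟨y, ?_, ?_, ?_, ?_, ?_⟩
  · refine GlobalVec.ext_agreeAt fun p => ?_
    rcases p.cases_add with rfl | ⟨i, rfl⟩ | ⟨c, rfl⟩
    · simp [GlobalVec.AgreeAt, replaceUnobserved, H.init, initState]
    · simp [GlobalVec.AgreeAt, replaceUnobserved, H.init, initState]
    · simp [GlobalVec.AgreeAt, replaceUnobserved, (hact c).init, initState]
  · intro t p hp
    have hobs : ∀ q : Proc n, μ t = some q → ∃ g, LocalTrans A B (s t) (e t) (s (t + 1)) g q ∧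
        ∃ d, d ≠ p ∧ (replaceUnobserved hk (s (t + 1)) (st · (t + 1))).AgreeAt
          (replaceUnobserved hk (s t) (st · t)) d ∧
          (replaceUnobserved hk (s t) (st · t)).loc d ∈ g := by
      intro q hq
      obtain ⟨g, htr, p', hpq, hp'⟩ := H.step t q hq
      obtain ⟨d, hd1, hd2, hd3, -⟩ := exists_counterpart H hk hact hocc (t := t) (p := p')
        (by rw [hq]; exact fun h => hpq (Option.some_injective _ h).symm)
      refine ⟨g, htr, d, ?_, hd2, hd1 ▸ hp'⟩
      rintro rfl
      have := hd3 hp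
      rw [hq] at this
      simp at this
    rcases p.cases_add with rfl | ⟨i, rfl⟩ | ⟨c, rfl⟩
    · exact hobs .A hp
    · simp only [actorMovers, Fin.append_left] at hp
      simpa [LocalTrans, replaceUnobserved] using hobs _ hp
    · simp only [actorMovers, Fin.append_right] at hp
      simpa [LocalTrans, replaceUnobserved] using hy1 c t hp
  · intro t p hp
    rcases p.cases_add with rfl | ⟨i, rfl⟩ | ⟨c, rfl⟩
    · exact H.stay t .A hp
    · simp only [actorMovers, Fin.append_left] at hp
      simpa [GlobalVec.AgreeAt, replaceUnobserved] using H.stay t _ hp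
    · simp only [actorMovers, Fin.append_right] at hp
      simpa [GlobalVec.AgreeAt, replaceUnobserved] using (hact c).stay t hp
  · intro t p hp
    rcases p.cases_add with rfl | ⟨i, rfl⟩ | ⟨c, rfl⟩
    · exact H.input_kept t .A hp
    · simp only [actorMovers, Fin.append_left] at hp
      simpa [GlobalVec.AgreeAt, replaceUnobserved] using H.input_kept t _ hp
    · simp only [actorMovers, Fin.append_right] at hp
      simpa [GlobalVec.AgreeAt, replaceUnobserved] using hy2 c t hp
  · intro p t
    rcases p.cases_add with rfl | ⟨i, rfl⟩ | ⟨c, rfl⟩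
    · exact H.fair .A t
    · simpa [actorMovers] using H.fair (.B (Fin.castLE hk i)) t
    · simpa [actorMovers] using (hact c).fair t

/-- The serialized lazy run is a stuttering both of the given run, as far as observed, and of the
run left after deleting idle steps; the formula passes from one to the other through it. The
serialization stutters on the observed processes because `μ t` names at most one mover. -/
theorem satEUncond_of_cover (H : IsLazyRun A B s e μ) (hk : k ≤ n) {m : ℕ}
    (hc : Cover B k s μ Set.univ m) {h : LTLX (AP QA IA QB IB k)}
    (hsat : h.Sat (fun t => obs (Fin.castLE hk) (s t) (e t)) 0) : SatEUncond A B h (k + m) := by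
  obtain ⟨st, mv, hact, hocc⟩ := hc
  obtain ⟨y, hy⟩ := H.exists_concurrentRun hk hact hocc
  let O : Proc (k + m) → Prop := fun p => p = .A ∨ ∃ i, p = .B (Fin.castAdd m i)
  obtain ⟨s', e', μ', f, H', hf, hO⟩ := hy.exists_lazyRun (O := O) (by
    rintro t p p' (rfl | ⟨i, rfl⟩) (rfl | ⟨i', rfl⟩) h1 h2
    · rfl
    all_goals
      simp only [actorMovers, Fin.append_left] at h1 h2
      rw [h1] at h2
      simp at h2
    simp [h2])
  obtain ⟨x, f', hx, hfair, hf', hxs⟩ := H'.exists_run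
  refine ⟨Nat.le_add_right k m, x, hx, hfair, ?_⟩
  have hw : ∀ T, obs (Fin.castAdd m) (s' T) (e' T) =
      obs (Fin.castLE hk) (s (f T)) (e (f T)) := fun T => by
    have hA := hO T .A (Or.inl rfl)
    have hB := fun i => hO T (.B (Fin.castAdd m i)) (Or.inr ⟨i, rfl⟩)
    refine obs_congr hA.1 (fun i => Eq.trans (hB i).1 ?_) hA.2 fun i => Eq.trans (hB i).2 ?_ <;>
    simp [replaceUnobserved]
  have h1 := LTLX.sat_stutter (w := fun T => obs (Fin.castAdd m) (s' T) (e' T)) hf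
    (v := fun t => obs (Fin.castLE hk) (s t) (e t)) hw h 0
  have h2 := LTLX.sat_stutter (w := fun T => obs (Fin.castAdd m) (s' T) (e' T)) hf'
    (v := trace (Fin.castLE (Nat.le_add_right k m)) x) (fun T => by
      rw [trace_eq_obs, (hxs T).1, (hxs T).2]
      rfl) h 0
  rw [hf.zero] at h1
  rw [hf'.zero] at h2
  exact h2.1 (h1.2 hsat)

end GuardedProtocol

/-! ### Counting the actors needed to occupy all states -/

namespace GuardedProtocol

variable {QA IA QB IB : Type*}
variable {A : ProcessTemplate QA IA (QA ⊕ QB)} {B : ProcessTemplate QB IB (QA ⊕ QB)}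
variable {k n : ℕ} {s : ℕ → GlobalVec QA QB n} {e : ℕ → GlobalVec IA IB n}
  {μ : ℕ → Option (Proc n)}

theorem exists_infinitely_often_of_finite {ι : Type*} [Finite ι] {P : ι → ℕ → Prop}
    (h : ∀ T, ∃ t, T ≤ t ∧ ∃ i, P i t) : ∃ i, ∀ T, ∃ t, T ≤ t ∧ P i t := by
  by_contra! hc
  choose T hT using hc
  have := Fintype.ofFinite ι
  obtain ⟨t, ht, i, hi⟩ := h (Finset.univ.sup T)
  exact hT i t ((Finset.le_sup (Finset.mem_univ i)).trans ht) hi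

theorem cover_card {S : Set QB} {C : Type*} [Fintype C] {st : C → ℕ → QB} {mv : C → ℕ → Prop}
    (hact : ∀ c, IsActor B k s μ (st c) (mv c)) (hocc : Occupies k s μ S st mv) :
    Cover B k s μ S (Fintype.card C) := by
  refine ⟨fun c => st ((Fintype.equivFin C).symm c), fun c => mv ((Fintype.equivFin C).symm c),
    fun c => hact _, fun t i hi hS hμ => ?_⟩
  obtain ⟨d, hd⟩ := hocc t i hi hS hμ
  exact ⟨Fintype.equivFin C d, by simpa using hd⟩

theorem cover_empty : Cover B k s μ ∅ 0 :=
  ⟨Fin.elim0, Fin.elim0, fun c => c.elim0, fun _ _ _ h => h.elim⟩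

theorem IsActor.cover_one {S : Set QB} {st : ℕ → QB} {mv : ℕ → Prop}
    (hact : IsActor B k s μ st mv) (hocc : ∀ t (i : Fin n), k ≤ i → (s t).b i ∈ S →
      μ t ≠ some (.B i) → st t = (s t).b i ∧ (mv t → μ t = none)) : Cover B k s μ S 1 :=
  ⟨fun _ => st, fun _ => mv, fun _ => hact, fun t i hi hS hμ => ⟨0, hocc t i hi hS hμ⟩⟩

theorem Cover.union {S S' : Set QB} {m m' : ℕ} (h : Cover B k s μ S m)
    (h' : Cover B k s μ S' m') : Cover B k s μ (S ∪ S') (m + m') := by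
  obtain ⟨st, mv, hact, hocc⟩ := h
  obtain ⟨st', mv', hact', hocc'⟩ := h'
  have := cover_card (C := Fin m ⊕ Fin m') (st := Sum.elim st st') (mv := Sum.elim mv mv')
    (S := S ∪ S') (B := B) (k := k) (s := s) (μ := μ)
    (fun c => by cases c; exacts [hact _, hact' _]) fun t i hi hS hμ => by
      rcases hS with hS | hS
      · obtain ⟨d, hd⟩ := hocc t i hi hS hμ
        exact ⟨.inl d, hd⟩
      · obtain ⟨d, hd⟩ := hocc' t i hi hS hμ
        exact ⟨.inr d, hd⟩
  simpa using this

theorem IsLazyRun.b_succ (H : IsLazyRun A B s e μ) {t : ℕ} {j : Fin n}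
    (h : μ t ≠ some (.B j)) : (s (t + 1)).b j = (s t).b j :=
  H.stay t (.B j) h

theorem IsLazyRun.isActor_copy (H : IsLazyRun A B s e μ) (j : Fin n) :
    IsActor B k s μ (fun t => (s t).b j) (fun t => μ t = some (.B j)) :=
  ⟨by simp [H.init, initState], fun _ ht => Or.inl ⟨j, ht, rfl, rfl⟩, fun _ ht => H.b_succ ht,
    fun t => H.fair _ t⟩

theorem IsLazyRun.cover_univ (H : IsLazyRun A B s e μ) : Cover B k s μ Set.univ (n - k) := by
  refine ⟨fun c t => (s t).b ⟨k + c, by omega⟩, fun c t => μ t = some (.B ⟨k + c, by omega⟩),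
    fun c => H.isActor_copy _, fun t i hi _ hμ => ⟨⟨i - k, by omega⟩, ?_⟩⟩
  have : (⟨k + (i - k), by omega⟩ : Fin n) = i := Fin.ext (by simp; omega)
  simp only [this, true_and]
  exact fun h => absurd h hμ

/-- An extra actor can always shadow some copy `B j`; extra actors never hurt occupation. -/
theorem IsLazyRun.cover_add_one (H : IsLazyRun A B s e μ) (j : Fin n) {S : Set QB} {m : ℕ}
    (h : Cover B k s μ S m) : Cover B k s μ S (m + 1) := by
  have : Cover B k s μ ∅ 1 :=
    (H.isActor_copy j).cover_one fun _ _ _ h => h.elim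
  simpa using h.union this

theorem exists_first_visit {q : QB} (h : ∃ t, ∃ i : Fin n, k ≤ i ∧ (s t).b i = q) :
    ∃ (τ : ℕ) (f : Fin n), (s τ).b f = q ∧ ∀ t (i : Fin n), k ≤ i → (s t).b i = q → τ ≤ t := by
  classical
  obtain ⟨f, -, hf⟩ := Nat.find_spec h
  exact ⟨Nat.find h, f, hf, fun t i hi hq => Nat.find_min' h ⟨i, hi, hq⟩⟩

/-- One actor moves to `q` with the first process that visits `q`, and leaves it with the last. -/
theorem IsLazyRun.cover_singleton_of_finitely_often (H : IsLazyRun A B s e μ) (j : Fin n) {q : QB}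
    (h : ∃ T, ∀ t, T ≤ t → ∀ i : Fin n, k ≤ i → (s t).b i ≠ q) : Cover B k s μ {q} 1 := by
  classical
  by_cases hv : ∃ t, ∃ i : Fin n, k ≤ i ∧ (s t).b i = q
  swap
  · push Not at hv
    refine H.cover_add_one j ⟨Fin.elim0, Fin.elim0, fun c => c.elim0, fun t i hi hS => ?_⟩
    exact absurd hS (hv t i hi)
  obtain ⟨τ, f, hf, hτ⟩ := exists_first_visit hv
  obtain ⟨L, l, hl, hlq, hL⟩ : ∃ (L : ℕ) (l : Fin n), k ≤ l ∧ (s L).b l = q ∧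
      ∀ t (i : Fin n), k ≤ i → (s t).b i = q → t ≤ L := by
    obtain ⟨t, i, hi, hq⟩ := hv
    have h0 : Nat.find h ≠ 0 := fun h0 =>
      Nat.find_spec h t (h0 ▸ Nat.zero_le t) i hi hq
    have h1 := Nat.find_min h (m := Nat.find h - 1) (by omega)
    push Not at h1
    obtain ⟨L, hL, l, hl, hlq⟩ := h1
    refine ⟨L, l, hl, hlq, fun t' i' hi' hq' => ?_⟩
    by_contra hc
    exact Nat.find_spec h t' (by omega) i' hi' hq'
  have hτL : τ ≤ L := hτ L l hl hlq
  refine IsActor.cover_one (st := fun t => if t ≤ L then (s (min t τ)).b f else (s t).b l)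
    (mv := fun t => (t < τ ∧ μ t = some (.B f)) ∨ (L ≤ t ∧ μ t = some (.B l)))
    ⟨?_, ?_, ?_, ?_⟩ ?_
  · simp [H.init, initState]
  · rintro t (⟨ht, hμ⟩ | ⟨ht, hμ⟩)
    · refine Or.inl ⟨f, hμ, ?_, ?_⟩
      · rw [if_pos (by omega), min_eq_left ht.le]
      · rw [if_pos (by omega), min_eq_left (by omega)]
    · refine Or.inl ⟨l, hμ, ?_, by rw [if_neg (by omega)]⟩
      split_ifs with h1
      · obtain rfl : t = L := le_antisymm h1 ht
        rw [min_eq_right hτL, hf, hlq]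
      · rfl
  · intro t ht
    push Not at ht
    rcases lt_or_ge t τ with h1 | h1
    · rw [if_pos (by omega), if_pos (by omega), min_eq_left (by omega), min_eq_left h1.le]
      exact H.b_succ (ht.1 h1)
    · rcases lt_or_ge t L with h2 | h2
      · rw [if_pos (by omega), if_pos h2.le, min_eq_right h1, min_eq_right (by omega)]
      · rw [if_neg (by omega), H.b_succ (ht.2 h2)]
        split_ifs with h3
        · obtain rfl : t = L := le_antisymm h3 h2
          rw [min_eq_right h1, hf, hlq]
        · rfl
  · intro t
    obtain ⟨t', h1, h2⟩ := H.fair (.B l) (max t L)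
    exact ⟨t', by omega, Or.inr ⟨by omega, h2⟩⟩
  · intro t i hi hS hμ
    have hq : (s t).b i = q := hS
    have h1 := hτ t i hi hq
    have h2 := hL t i hi hq
    refine ⟨by rw [if_pos h2, min_eq_right h1, hf, hq], ?_⟩
    -- A resting copy in `q` is still there at `t + 1`, so `t < L` and the actor has not yet started
    -- to follow `l`.
    have h3 := hL (t + 1) i hi
    rw [H.b_succ hμ] at h3
    have := h3 hq
    omega

/-- The state of `B j` is constant from a visit to its next move, so that move starts in `q`. -/
theorem IsLazyRun.exists_move_from (H : IsLazyRun A B s e μ) {j : Fin n} {q : QB}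
    (h : ∀ T, ∃ t, T ≤ t ∧ (s t).b j = q) (T : ℕ) :
    ∃ t, T ≤ t ∧ μ t = some (.B j) ∧ (s t).b j = q := by
  classical
  obtain ⟨t, ht, hq⟩ := h T
  have hex := H.fair (.B j) t
  obtain ⟨h1, h2⟩ := Nat.find_spec hex
  refine ⟨Nat.find hex, ht.trans h1, h2, ?_⟩
  have : ∀ u, t ≤ u → u ≤ Nat.find hex → (s u).b j = q := by
    intro u hu
    induction u, hu using Nat.le_induction with
    | base => exact fun _ => hq
    | succ u hu ih =>
      intro hlt
      rw [H.b_succ fun hc => Nat.find_min hex hlt ⟨hu, hc⟩]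
      exact ih (by omega)
  exact this _ h1 le_rfl

/-- If `B j` visits the states in `S` infinitely often, then one actor for each state in `S` and one
actor that moves with `B j` occupy `S`. They exchange their roles whenever `B j` moves from a state
in `S`, so that all of them move infinitely often. -/
theorem IsLazyRun.cover_finset (H : IsLazyRun A B s e μ) {j : Fin n} (hj : k ≤ j) (S : Finset QB)
    (h : ∀ q ∈ S, ∀ T, ∃ t, T ≤ t ∧ (s t).b j = q) : Cover B k s μ S (S.card + 1) := by
  classical
  have hvisit : ∀ q : S, ∃ (τ : ℕ) (f : Fin n), (s τ).b f = q ∧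
      ∀ t (i : Fin n), k ≤ i → (s t).b i = q → τ ≤ t := fun q => by
    obtain ⟨t, -, ht⟩ := h q q.2 0
    exact exists_first_visit ⟨t, j, hj, ht⟩
  choose τ f hf hτ using hvisit
  let dep : ℕ → S → Prop := fun t q => μ t = some (.B j) ∧ (s t).b j = q
  let target : ℕ → Option S := fun t => if h : ∃ q, dep t q then some h.choose else none
  have htarget : ∀ t q, target t = some q ↔ dep t q := by
    intro t q
    by_cases hq : ∃ q, dep t q
    · have h1 : target t = some hq.choose := dif_pos hq
      rw [h1, Option.some_inj]
      exact ⟨fun h2 => h2 ▸ hq.choose_spec, fun h2 =>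
        Subtype.ext (hq.choose_spec.2.symm.trans h2.2)⟩
    · have h1 : target t = none := dif_neg hq
      rw [h1]
      exact ⟨fun h2 => by simp at h2, fun h2 => absurd ⟨q, h2⟩ hq⟩
  have hdepτ : ∀ t q, target t = some q → τ q ≤ t := fun t q hq =>
    hτ q t j hj ((htarget t q).1 hq).2
  -- Role `none` follows `B j`; role `some q` reaches `q` with its first visitor and waits there.
  -- When `B j` moves from `q`, the waiting actor goes with it and the follower remains in `q`, so
  -- the two roles are swapped.
  let role : ℕ → Equiv.Perm (Option S) := fun t =>
    Nat.rec 1 (fun t r => Equiv.swap none (target t) * r) t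
  have hrole : ∀ t c, role (t + 1) c = Equiv.swap none (target t) (role t c) := fun _ _ => rfl
  let pos : Option S → ℕ → QB := fun o t =>
    o.elim ((s t).b j) fun q => (s (min t (τ q))).b (f q)
  let mv : Option S → ℕ → Prop := fun o t =>
    o.elim (μ t = some (.B j) ∧ target t = none) fun q =>
      (t < τ q ∧ μ t = some (.B (f q))) ∨ target t = some q
  have hmem : ∀ q t, τ q ≤ t → pos (some q) t = q := fun q t ht => by
    simp only [pos, Option.elim_some, min_eq_right ht, hf]
  have hbranch : ∀ q t, target t ≠ some q → Equiv.swap none (target t) (some q) = some q :=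
    fun q t ht => Equiv.swap_apply_of_ne_of_ne (by simp) ht.symm
  have key : ∀ (c : Option S), IsActor B k s μ (fun t => pos (role t c) t)
      (fun t => mv (role t c) t) := by
    intro c
    refine ⟨?_, fun t ht => Or.inl ?_, fun t ht => ?_, fun T => ?_⟩
    · cases c <;> simp [role, pos, H.init, initState]
    · rw [hrole]
      rcases hc : role t c with _ | q
      · rw [hc] at ht
        obtain ⟨h1, h2⟩ := ht
        exact ⟨j, h1, rfl, by rw [h2, Equiv.swap_self]; rfl⟩
      · rw [hc] at ht
        by_cases h2 : target t = some q
        · have hd := (htarget t q).1 h2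
          refine ⟨j, hd.1, ?_, ?_⟩
          · rw [hmem q t (hdepτ t q h2), hd.2]
          · rw [h2, Equiv.swap_apply_right]; rfl
        · obtain ⟨h3, h4⟩ := ht.resolve_right h2
          refine ⟨f q, h4, ?_, ?_⟩
          · simp only [pos, Option.elim_some, min_eq_left h3.le]
          · rw [hbranch q t h2]
            simp only [pos, Option.elim_some, min_eq_left (Nat.succ_le_of_lt h3)]
    · rw [hrole]
      rcases hc : role t c with _ | q
      · rw [hc] at ht
        rw [Equiv.swap_apply_left]
        rcases h2 : target t with _ | q
        · exact H.b_succ fun h1 => ht ⟨h1, h2⟩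
        · rw [hmem q _ ((hdepτ t q h2).trans (Nat.le_succ t))]
          exact ((htarget t q).1 h2).2.symm
      · rw [hc] at ht
        simp only [mv, Option.elim_some] at ht
        push Not at ht
        rw [hbranch q t ht.2]
        rcases lt_or_ge t (τ q) with h3 | h3
        · simp only [pos, Option.elim_some, min_eq_left h3.le, min_eq_left (Nat.succ_le_of_lt h3)]
          exact H.b_succ (ht.1 h3)
        · rw [hmem q _ h3, hmem q _ (h3.trans (Nat.le_succ t))]
    · by_contra! hno
      by_cases hex : ∃ t₀ q, T ≤ t₀ ∧ role t₀ c = some q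
      · obtain ⟨t₀, q, hT, hq⟩ := hex
        have hstay : ∀ t, t₀ ≤ t → role t c = some q := by
          intro t ht
          induction t, ht using Nat.le_induction with
          | base => exact hq
          | succ t ht ih =>
            rw [hrole, ih]
            refine hbranch q t fun hc => hno t (hT.trans ht) ?_
            rw [ih]
            exact Or.inr hc
        obtain ⟨t, h1, h2, h3⟩ := H.exists_move_from (h q q.2) t₀
        refine hno t (hT.trans h1) ?_
        rw [hstay t h1]
        exact Or.inr ((htarget t q).2 ⟨h2, h3⟩)
      · push Not at hex
        have hnone : ∀ t, T ≤ t → role t c = none := fun t ht =>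
          Option.eq_none_iff_forall_ne_some.2 fun q => hex t q ht
        obtain ⟨t, h1, h2⟩ := H.fair (.B j) T
        rcases h3 : target t with _ | q
        · refine hno t h1 ?_
          rw [hnone t h1]
          exact ⟨h2, h3⟩
        · refine hex (t + 1) q (h1.trans (Nat.le_succ t)) ?_
          rw [hrole, hnone t h1, Equiv.swap_apply_left, h3]
  have := cover_card (S := (S : Set QB)) key fun t i hi hS hμ => by
    have hq : τ ⟨_, hS⟩ ≤ t := hτ ⟨_, hS⟩ t i hi rfl
    -- While `B j` is moving from this state, it is the follower that rests there; otherwise it is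
    -- the waiting actor.
    by_cases h2 : target t = some ⟨_, hS⟩
    · have hd := (htarget t _).1 h2
      refine ⟨(role t).symm none, ?_, ?_⟩
      · simp only [Equiv.apply_symm_apply]
        exact hd.2
      · simp only [Equiv.apply_symm_apply]
        intro hm
        have := hm.2
        rw [h2] at this
        simp at this
    · refine ⟨(role t).symm (some ⟨_, hS⟩), ?_, ?_⟩
      · simp only [Equiv.apply_symm_apply]
        exact hmem _ t hq
      · simp only [Equiv.apply_symm_apply]
        rintro (hm | hm)
        · omega
        · exact absurd hm h2
  simpa using this

/-- If some `B j` finally stays in `r`, and an observed process visits `r` infinitely often, then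
one actor in `r` can move infinitely often by self-loops. -/
theorem IsLazyRun.cover_singleton_of_idleLoop (H : IsLazyRun A B s e μ)
    (hidle : ∀ t, μ (t + 1) ≠ none → μ t = none) {r : QB} {j : Fin n} (hj : k ≤ j)
    (hjr : ∃ T, ∀ t, T ≤ t → (s t).b j = r) {i : Fin n} (hi : (i : ℕ) < k)
    (hir : ∀ T, ∃ t, T ≤ t ∧ (s t).b i = r) : Cover B k s μ {r} 1 := by
  obtain ⟨T₀, hT₀⟩ := hjr
  obtain ⟨τ, f, hf, hτ⟩ := exists_first_visit ⟨T₀, j, hj, hT₀ T₀ le_rfl⟩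
  have hbefore : ∀ t p, μ (t + 1) = some p → μ t = none ∧ s (t + 1) = s t := fun t p hp => by
    have h0 : μ t = none := hidle t (by simp [hp])
    exact ⟨h0, GlobalVec.ext_agreeAt fun p' => H.stay t p' (by simp [h0])⟩
  refine IsActor.cover_one (st := fun t => (s (min t τ)).b f) (mv := fun t =>
    (t < τ ∧ μ t = some (.B f)) ∨ (τ ≤ t ∧ μ t = none ∧ IdleLoop B k (s t) r)) ⟨?_, ?_, ?_, ?_⟩ ?_
  · simp [H.init, initState]
  · rintro t (⟨ht, hμ⟩ | ⟨ht, hμ, hl⟩)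
    · exact Or.inl ⟨f, hμ, by rw [min_eq_left ht.le], by rw [min_eq_left (by omega)]⟩
    · refine Or.inr ⟨hμ, ?_⟩
      rw [min_eq_right ht, min_eq_right (ht.trans (Nat.le_succ t)), hf]
      exact ⟨hl, rfl⟩
  · intro t ht
    rcases lt_or_ge t τ with h1 | h1
    · rw [min_eq_left h1.le, min_eq_left (Nat.succ_le_of_lt h1)]
      exact H.b_succ fun h2 => ht (Or.inl ⟨h1, h2⟩)
    · rw [min_eq_right h1, min_eq_right (h1.trans (Nat.le_succ t))]
  · intro T
    -- A self-loop whose guard contains `r` can be taken whenever the observed `B i` is in `r`, in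
    -- particular at the idle step before `B i` moves from `r`. If there is none, each late
    -- self-loop of `B j` has its guard satisfied from a state other than `r`, and the actor copies
    -- it one idle step earlier.
    by_cases hself : ∃ σ g, B.trans r σ g r ∧ Sum.inr r ∈ g
    · obtain ⟨σ, g, htr, hg⟩ := hself
      obtain ⟨t, h1, h2, h3⟩ := H.exists_move_from hir (T + τ + 1)
      obtain ⟨u, rfl⟩ : ∃ u, t = u + 1 := ⟨t - 1, by omega⟩
      obtain ⟨h4, h5⟩ := hbefore u _ h2
      refine ⟨u, by omega, Or.inr ⟨by omega, h4, σ, g, htr, .B i, ?_, ?_⟩⟩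
      · rw [← h5, GlobalVec.loc, h3]
        exact hg
      · rintro i' hi' hk
        obtain rfl : i = i' := by simpa using hi'
        omega
    · obtain ⟨t, h1, h2⟩ := H.fair (.B j) (T + τ + T₀ + 1)
      obtain ⟨u, rfl⟩ : ∃ u, t = u + 1 := ⟨t - 1, by omega⟩
      obtain ⟨h4, h5⟩ := hbefore u _ h2
      obtain ⟨g, htr, p, -, hp⟩ := H.step _ _ h2
      simp only [LocalTrans] at htr
      rw [hT₀ (u + 1) (by omega), hT₀ (u + 1 + 1) (by omega)] at htr
      refine ⟨u, by omega, Or.inr ⟨by omega, h4, _, g, htr, p, h5 ▸ hp, ?_⟩⟩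
      rintro i' rfl - hr
      refine hself ⟨_, g, htr, ?_⟩
      rwa [h5, GlobalVec.loc, hr] at hp
  · intro t i' hi' hS hμ
    have hq : (s t).b i' = r := hS
    have h1 := hτ t i' hi' hq
    refine ⟨by rw [min_eq_right h1, hf, hq], ?_⟩
    rintro (h2 | h2)
    · omega
    · exact h2.2.1

theorem cover_finset_of_forall (h : ∀ q, Cover B k s μ {q} 2) (S : Finset QB) :
    Cover B k s μ S (2 * S.card) := by
  classical
  induction S using Finset.induction_on with
  | empty => simpa using cover_empty
  | insert q S hq ih =>
    rw [Finset.card_insert_of_notMem hq, Finset.coe_insert, Set.insert_eq,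
      show 2 * (S.card + 1) = 2 + 2 * S.card by ring]
    exact (h q).union ih

/-- Two actors per state always suffice; it is enough to find one nonempty set `S` that saves an
actor, and `{r}` or `{q, r}` does so, where `B₁` visits `r` infinitely often. -/
theorem IsLazyRun.cover_univ_two_mul_card_sub_one [Fintype QB] (H : IsLazyRun A B s e μ)
    (hidle : ∀ t, μ (t + 1) ≠ none → μ t = none) (hk : 1 ≤ k) (hkn : k ≤ n) :
    Cover B k s μ Set.univ (2 * Fintype.card QB - 1) := by
  classical
  let j₀ : Fin n := ⟨0, by omega⟩
  have hdich : ∀ q, Cover B k s μ {q} 1 ∨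
      ∃ j : Fin n, k ≤ j ∧ ∀ T, ∃ t, T ≤ t ∧ (s t).b j = q := by
    intro q
    by_cases hq : ∃ T, ∀ t, T ≤ t → ∀ i : Fin n, k ≤ i → (s t).b i ≠ q
    · exact Or.inl (H.cover_singleton_of_finitely_often j₀ hq)
    · push Not at hq
      obtain ⟨j, hj⟩ := exists_infinitely_often_of_finite
        (P := fun (i : Fin n) t => k ≤ i ∧ (s t).b i = q) hq
      obtain ⟨-, -, hkj, -⟩ := hj 0
      exact Or.inr ⟨j, hkj, fun T => (hj T).imp fun t ht => ⟨ht.1, ht.2.2⟩⟩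
  have htwo : ∀ q, Cover B k s μ {q} 2 := by
    intro q
    rcases hdich q with h | ⟨j, hkj, hj⟩
    · exact H.cover_add_one j₀ h
    · simpa using H.cover_finset hkj {q} (by simpa using hj)
  obtain ⟨r, hr⟩ := exists_infinitely_often_of_finite (P := fun q t => (s t).b j₀ = q)
    fun T => ⟨T, le_rfl, _, rfl⟩
  have hsave : ∃ S : Finset QB, S.Nonempty ∧ Cover B k s μ S (2 * S.card - 1) := by
    by_cases hone : Cover B k s μ {r} 1
    · exact ⟨{r}, by simp, by simpa using hone⟩
    obtain ⟨j, hkj, hj⟩ := (hdich r).resolve_left hone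
    have hleave : ∀ T, ∃ t, T ≤ t ∧ ∃ q : {q // q ≠ r}, (s t).b j = q := by
      by_contra! hc
      obtain ⟨T, hT⟩ := hc
      refine hone (H.cover_singleton_of_idleLoop hidle hkj ⟨T, fun t ht => ?_⟩
        (i := j₀) hk hr)
      by_contra hne
      exact hT t ht ⟨_, hne⟩ rfl
    obtain ⟨⟨q, hqr⟩, hq⟩ := exists_infinitely_often_of_finite
      (P := fun (q : {q // q ≠ r}) t => (s t).b j = q) hleave
    refine ⟨{q, r}, by simp, ?_⟩
    have := H.cover_finset hkj {q, r} (by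
      simp only [Finset.mem_insert, Finset.mem_singleton, forall_eq_or_imp, forall_eq]
      exact ⟨hq, hj⟩)
    rwa [Finset.card_pair hqr] at this ⊢
  obtain ⟨S, hS, hcov⟩ := hsave
  have h1 := hcov.union (cover_finset_of_forall htwo Sᶜ)
  rw [← Finset.coe_union, Finset.union_compl, Finset.coe_univ] at h1
  have h2 := Finset.card_add_card_compl S
  have h3 := hS.card_pos
  rwa [show 2 * S.card - 1 + 2 * Sᶜ.card = 2 * Fintype.card QB - 1 by omega] at h1

/-! ### Monotonicity, bounding and cutoffs -/

theorem exists_lazyRun_of_satEUncond {h : LTLX (AP QA IA QB IB k)} (hs : SatEUncond A B h n) :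
    ∃ (hk : k ≤ n) (s : ℕ → GlobalVec QA QB n) (e : ℕ → GlobalVec IA IB n)
      (μ : ℕ → Option (Proc n)), IsLazyRun A B s e μ ∧ (∀ t, μ (t + 1) ≠ none → μ t = none) ∧
        h.Sat (fun t => obs (Fin.castLE hk) (s t) (e t)) 0 := by
  obtain ⟨hk, x, hx, hf, hsat⟩ := hs
  refine ⟨hk, _, _, _, hx.isLazyRun hf, fun t ht => ?_, ?_⟩
  · have : (t + 1) % 2 ≠ 0 := fun h => ht (if_pos h)
    exact if_pos (by omega)
  · exact (LTLX.sat_stutter isStutter_div_two (fun t => (trace_eq_obs _ x (t / 2)).symm) h 0).2 hsat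

/-- All unobserved copies serve as their own actors, and one more actor shadows `B₁`. -/
theorem SatEUncond.succ {h : LTLX (AP QA IA QB IB k)} (hn : 1 ≤ n) (hs : SatEUncond A B h n) :
    SatEUncond A B h (n + 1) := by
  obtain ⟨hk, s, e, μ, H, -, hsat⟩ := exists_lazyRun_of_satEUncond hs
  have := satEUncond_of_cover H hk (H.cover_add_one ⟨0, hn⟩ H.cover_univ) hsat
  rwa [show k + (n - k + 1) = n + 1 by omega] at this

theorem SatEUncond.mono {h : LTLX (AP QA IA QB IB k)} {n' : ℕ} (hn : 1 ≤ n) (hnn' : n ≤ n')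
    (hs : SatEUncond A B h n) : SatEUncond A B h n' := by
  induction n', hnn' using Nat.le_induction with
  | base => exact hs
  | succ n' hnn' ih => exact ih.succ (hn.trans hnn')

theorem SatEUncond.bounding [Fintype QB] {h : LTLX (AP QA IA QB IB k)} (hk : 1 ≤ k)
    (hs : SatEUncond A B h n) : SatEUncond A B h (2 * Fintype.card QB + k - 1) := by
  obtain ⟨hkn, s, e, μ, H, hidle, hsat⟩ := exists_lazyRun_of_satEUncond hs
  have := satEUncond_of_cover H hkn (H.cover_univ_two_mul_card_sub_one hidle hk hkn) hsat
  -- Needed because subtraction is truncated; `B.init` makes the state set nonempty.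
  have hpos : 0 < Fintype.card QB := Fintype.card_pos_iff.2 ⟨B.init⟩
  rwa [show k + (2 * Fintype.card QB - 1) = 2 * Fintype.card QB + k - 1 by omega] at this

theorem isCutoff_satEUncond [Fintype QB] (A : ProcessTemplate QA IA (QA ⊕ QB))
    (B : ProcessTemplate QB IB (QA ⊕ QB)) (hk : 1 ≤ k) (h : LTLX (AP QA IA QB IB k)) :
    IsCutoff (SatEUncond A B h) (2 * Fintype.card QB + k - 1) := fun n hn => by
  have hpos : 0 < Fintype.card QB := Fintype.card_pos_iff.2 ⟨B.init⟩
  exact ⟨fun hs => hs.bounding hk, fun hs => hs.mono (by omega) hn⟩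

end GuardedProtocol

open GuardedProtocol

theorem mainTheorem1 {QA IA QB IB : Type*} [Finite QA] [Finite IA] [Fintype QB] [Finite IB]
    (A : ProcessTemplate QA IA (QA ⊕ QB)) (B : ProcessTemplate QB IB (QA ⊕ QB)) :
    (∀ h : LTLX (AP QA IA QB IB 1),
      (∀ n : ℕ, 1 ≤ n → SatEUncond A B h n → SatEUncond A B h (n + 1)) ∧
      (∀ n : ℕ, 2 * Fintype.card QB < n →
        SatEUncond A B h n → SatEUncond A B h (2 * Fintype.card QB)) ∧
      IsCutoff (SatEUncond A B h) (2 * Fintype.card QB)) ∧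
    (∀ k : ℕ, 1 ≤ k → ∀ h : LTLX (AP QA IA QB IB k),
      IsCutoff (SatEUncond A B h) (2 * Fintype.card QB + k - 1)) :=
  -- For `k = 1` the general bound `2 * Fintype.card QB + 1 - 1` is definitionally `2 * Fintype.card
  -- QB`.
  ⟨fun h => ⟨fun _ hn hs => hs.succ hn, fun _ _ hs => hs.bounding le_rfl,
    isCutoff_satEUncond A B le_rfl h⟩, fun _ hk h => isCutoff_satEUncond A B hk h⟩
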